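/- Let $n\ge 2$, $0\le l\le m$, let $d\ge 0$ be an even integer, let $f_1,\dots,f_m,g\in\mathbb{R}[x_1,\dots,x_n]$ have degrees at most $d$, and put $$E=\{x\in\mathbb{R}^n \mid f_1(x)=\dots=f_l(x)=0,\ f_{l+1}(x)\ge 0,\dots,f_m(x)\ge 0\},\qquad E^{\min}=\{x\in E\mid g(x)\le g(y)\text{ for all }y\in E\}.$$ Let $q_0=n+1$, let $q_1<\dots<q_m$ be the first $m$ primes greater than $n+1$, and let $a_{ij}=\frac{1}{q_i-j}$ for $0\le i\le m$, $0\le j\le n$. Let $T_d$ be the Chebyshev polynomial (of the first kind) of degree $d$, and put $$\tilde g=\sum_{j=1}^n a_{0j}T_d(x_j),\qquad \tilde f_i=a_{i0}+\sum_{j=1}^n a_{ij}\,(T_d(x_j)+1)\quad(1\le i\le m),$$ $$G(t,x)=t\,g(x)+(1-t)\,\tilde g(x),\qquad F_i^{\pm}(t,x)=t\,f_i(x)\pm(1-t)\,\tilde f_i(x).$$ For $S\subset\{1,\dots,m\}$ and $\sigma\in\{+,-\}^S$ let $$\hat V_{S,\sigma}=\Big\{(t,x,\lambda)\in\mathbb{A}^1_{\mathbb{C}}\times\mathbb{A}^n_{\mathbb{C}}\times\mathbb{P}^{|S|}_{\mathbb{C}}\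 \Big|\ F_i^{\sigma_i}(t,x)=0\ \ \forall i\in S,\quad \lambda_0\nabla_xG(t,x)=\sum_{i\in S}\lambda_i\nabla_xF_i^{\sigma_i}(t,x)\Big\},$$ where the homogeneous coordinates $\lambda$ are indexed by $\{0\}\cup S$, and let $V_{S,\sigma}$ be the union of the irreducible components (for the Zariski topology) of $\hat V_{S,\sigma}$ that are not contained in a set $\{t=t_0\}$ with $t_0\in\mathbb{C}$. Let $\Pi_x$ denote the projection $(t,x,\lambda)\mapsto x$. Then for every compact connected component $C$ of $E^{\min}$ there exist a point $z\in C$, a set $S\subset\{1,\dots,m\}$ with $|S|\le n$, and $\sigma\in\{+,-\}^S$ with $\sigma_i=+$ for all $i\in S$ with $i\ge l+1$, such that $z\in\Pi_x\big(V_{S,\sigma}\cap\{t=1\}\big)$. -/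

import Mathlib

noncomputable section

namespace Deformation

open MvPolynomial

/-! ### The optimization problem -/

/-- The basic closed semialgebraic set `E`: the first `l` polynomials vanish,
the remaining ones are nonnegative (indices `0, …, m - 1`). -/
def feasibleSet {n m : ℕ} (l : ℕ) (f : Fin m → MvPolynomial (Fin n) ℝ) : Set (Fin n → ℝ) :=
  {x | (∀ i : Fin m, (i : ℕ) < l → eval x (f i) = 0) ∧ (∀ i : Fin m, l ≤ (i : ℕ) → 0 ≤ eval x (f i))}

/-- The set `E^min` of minimizers of `g` on `E`. -/
def minimizers {n m : ℕ} (l : ℕ) (f : Fin m → MvPolynomial (Fin n) ℝ)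
    (g : MvPolynomial (Fin n) ℝ) : Set (Fin n → ℝ) :=
  {x | x ∈ feasibleSet l f ∧ IsMinOn (fun y => eval y g) (feasibleSet l f) x}

/-! ### The deformation -/

/-- `q₀ = n + 1`, and `q₁ < q₂ < …` are the consecutive primes greater than `n + 1`. -/
def q (n : ℕ) : ℕ → ℕ
  | 0 => n + 1
  | i + 1 => Nat.nth (fun p => p.Prime ∧ n + 1 < p) i

/-- The entries `a_{ij} = 1 / (q_i - j)` of the Cauchy matrix. -/
def a (n i j : ℕ) : ℝ := 1 / ((q n i : ℝ) - (j : ℝ))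

/-- The Chebyshev polynomial `T_d` in the variable `x_j`. -/
def chebyshev {n : ℕ} (d : ℕ) (j : Fin n) : MvPolynomial (Fin n) ℝ :=
  Polynomial.aeval (X j : MvPolynomial (Fin n) ℝ) (Polynomial.Chebyshev.T ℝ (d : ℤ))

/-- `g̃ = ∑_{1 ≤ j ≤ n} a_{0j} T_d(x_j)`. -/
def gTilde (n d : ℕ) : MvPolynomial (Fin n) ℝ :=
  ∑ j : Fin n, C (a n 0 (j + 1)) * chebyshev d j

/-- `f̃_i = a_{i0} + ∑_{1 ≤ j ≤ n} a_{ij} (T_d(x_j) + 1)`; the `i`-th polynomial, counted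
from `0`, belongs to row `i + 1` of the matrix. -/
def fTilde (n d i : ℕ) : MvPolynomial (Fin n) ℝ :=
  C (a n (i + 1) 0) + ∑ j : Fin n, C (a n (i + 1) (j + 1)) * (chebyshev d j + 1)

/-- `G(t, x) = t g(x) + (1 - t) g̃(x)`, as a polynomial in `x` for every complex `t`. -/
def G {n : ℕ} (d : ℕ) (g : MvPolynomial (Fin n) ℝ) (t : ℂ) : MvPolynomial (Fin n) ℂ :=
  C t * map Complex.ofRealHom g + C (1 - t) * map Complex.ofRealHom (gTilde n d)

/-- `F_i^ε(t, x) = t f_i(x) + ε (1 - t) f̃_i(x)` for a sign `ε = ± 1`. -/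
def F {n m : ℕ} (d : ℕ) (f : Fin m → MvPolynomial (Fin n) ℝ) (i : Fin m) (ε : ℤˣ) (t : ℂ) :
    MvPolynomial (Fin n) ℂ :=
  C t * map Complex.ofRealHom (f i) +
    C (((ε : ℤ) : ℂ) * (1 - t)) * map Complex.ofRealHom (fTilde n d i)

/-! ### The space `𝔸 × 𝔸ⁿ × ℙ^{|S|}` with its Zariski topology -/

/-- Points `(t, x, λ)` of `𝔸 × 𝔸ⁿ × ℙ` over `ℂ`. The homogeneous coordinates `λ` are indexed by
`Option ι`: `none` is the index of `λ₀`, and `some i` is the index of `λ_i`. -/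
@[ext] structure Space (n : ℕ) (ι : Type) where
  t : ℂ
  x : Fin n → ℂ
  lam : Projectivization ℂ (Option ι → ℂ)

/-- The weight that counts the degree in the variables `λ` only. The variables are `t`
(`Sum.inl none`), `x_j` (`Sum.inl (some j)`) and the `λ`'s (`Sum.inr _`). -/
def lamWeight (n : ℕ) (ι : Type) : Option (Fin n) ⊕ Option ι → ℕ :=
  Sum.elim (fun _ => 0) (fun _ => 1)

/-- The zero locus in `𝔸 × 𝔸ⁿ × ℙ` of a polynomial in `t, x, λ` (to be used for polynomials that
are homogeneous in `λ`). -/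
def lamZeroLocus {n : ℕ} {ι : Type} (p : MvPolynomial (Option (Fin n) ⊕ Option ι) ℂ) :
    Set (Space n ι) :=
  {P | ∀ (v : Option ι → ℂ) (hv : v ≠ 0), Projectivization.mk ℂ v hv = P.lam →
    eval (Sum.elim (fun o => o.elim P.t P.x) v) p = 0}

/-- The Zariski topology on `𝔸 × 𝔸ⁿ × ℙ`: the complements of the zero loci of single polynomials
homogeneous in `λ` (a family closed under finite intersections) generate the open sets. -/
instance zariskiTopology (n : ℕ) (ι : Type) : TopologicalSpace (Space n ι) :=
  TopologicalSpace.generateFrom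
    {U | ∃ (p : MvPolynomial (Option (Fin n) ⊕ Option ι) ℂ) (k : ℕ),
      IsWeightedHomogeneous (lamWeight n ι) p k ∧ U = (lamZeroLocus p)ᶜ}

/-! ### The deformed Fritz John variety -/

/-- `V̂_{S,σ}`: the points `(t, x, λ)` with `F_i^{σ_i}(t, x) = 0` for all `i ∈ S` and
`λ₀ ∇ₓ G(t, x) = ∑_{i ∈ S} λ_i ∇ₓ F_i^{σ_i}(t, x)`. -/
def Vhat {n m : ℕ} (d : ℕ) (f : Fin m → MvPolynomial (Fin n) ℝ) (g : MvPolynomial (Fin n) ℝ)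
    (S : Finset (Fin m)) (σ : {i // i ∈ S} → ℤˣ) : Set (Space n {i // i ∈ S}) :=
  {P | (∀ i : {i // i ∈ S}, eval P.x (F d f i (σ i) P.t) = 0) ∧
    ∀ (v : Option {i // i ∈ S} → ℂ) (hv : v ≠ 0), Projectivization.mk ℂ v hv = P.lam →
      ∀ j : Fin n, v none * eval P.x (pderiv j (G d g P.t)) =
        ∑ i : {i // i ∈ S}, v (some i) * eval P.x (pderiv j (F d f i (σ i) P.t))}

/-- `V_{S,σ}`: the union of the irreducible components of `V̂_{S,σ}` (for the Zariski topology)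
that are not contained in a fiber `{t = t₀}`. -/
def V {n m : ℕ} (d : ℕ) (f : Fin m → MvPolynomial (Fin n) ℝ) (g : MvPolynomial (Fin n) ℝ)
    (S : Finset (Fin m)) (σ : {i // i ∈ S} → ℤˣ) : Set (Space n {i // i ∈ S}) :=
  ⋃ Z ∈ {Z ∈ irreducibleComponents (Vhat d f g S σ) | ¬ ∃ t₀ : ℂ, ∀ P ∈ Z, P.1.t = t₀},
    Subtype.val '' Z

end Deformation

end

/-!
For `0 ≤ t ≤ 1` consider the minimization of `G(t, ·)` over the relaxed set given by `F_i⁺ ≥ 0` for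
all `i` and `F_i⁻ ≤ 0` for the equations. Since `d` is even, `T_d ≥ -1`, so every `f̃_i` is positive
(`eval_fTilde_pos`). Hence the relaxed set contains `E`, and `F_i⁻ < F_i⁺` for `t < 1`.

A compact connected component `C` of the closed set `E^min` has arbitrarily small bounded open
neighbourhoods `W` whose frontier misses `E^min` (`exists_isOpen_frontier_inter_eq_empty`). A limit
for `t → 1` of minimizers of `G(t, ·)` over the part of the relaxed set in the closure of `W` lies
in `E^min`, so for `t` close to `1` these minimizers lie in `W` and are local minimizers over the
whole relaxed set (`exists_isLocalMinOn_relaxedSet`).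

At such a minimizer the Lagrange multiplier rule makes the gradients of `G` and of the active
constraints linearly dependent. If more than `n` constraints are active, any `n` of them will do,
because `n + 1` vectors in `ℝⁿ` are dependent (`exists_multipliers_of_isLocalMinOn`); this gives
`|S| ≤ n` without any genericity of the deformation.

So for some `S` and `σ` there are points of `V̂_{S,σ}` with `t < 1`, `t → 1`, and `x` tending to `C`.
The space `𝔸 × 𝔸ⁿ × ℙ` is Noetherian (`noetherianSpace_space`), so `V̂_{S,σ}` has finitely many
irreducible components, and one of them, `Z`, contains infinitely many of these points. After
normalizing the multipliers, a subsequence converges in the Euclidean topology. Zariski closed sets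
are Euclidean closed (`Cone.continuous_toSpace`), so `Z` contains the limit, which lies over `t = 1`
and over a point of `C`. As `Z` also contains points with `t < 1`, it is not contained in a fibre
of `t`.
-/

noncomputable section

namespace Deformation

open MvPolynomial Filter Topology

/-! ### Positivity of the perturbing polynomials -/

/-- An even Chebyshev polynomial is `T₂ ∘ T_e = 2 T_e ^ 2 - 1`, hence at least `-1` everywhere. -/
lemma neg_one_le_eval_chebyshev {n d : ℕ} (hd : Even d) (j : Fin n) (x : Fin n → ℝ) :
    -1 ≤ eval x (chebyshev d j) := by
  obtain ⟨e, rfl⟩ := hd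
  have h : eval x (chebyshev (e + e) j) =
      2 * ((Polynomial.Chebyshev.T ℝ (e : ℤ)).eval (x j)) ^ 2 - 1 := by
    have h1 : eval x (chebyshev (e + e) j) =
        (Polynomial.Chebyshev.T ℝ ((e + e : ℕ) : ℤ)).eval (x j) := by
      simp only [chebyshev, ← coe_aeval_eq_eval, RingHom.coe_coe,
        ← Polynomial.aeval_algHom_apply, aeval_X, Polynomial.coe_aeval_eq_eval]
    rw [h1, show ((e + e : ℕ) : ℤ) = 2 * (e : ℤ) by push_cast; ring,
      Polynomial.Chebyshev.T_mul, Polynomial.Chebyshev.T_two]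
    simp
  rw [h]
  nlinarith [sq_nonneg ((Polynomial.Chebyshev.T ℝ (e : ℤ)).eval (x j))]

lemma lt_q_succ (n i : ℕ) : n + 1 < q n (i + 1) := by
  have hinf : (Set.ofPred fun p : ℕ => p.Prime ∧ n + 1 < p).Infinite := by
    refine Set.infinite_of_not_bddAbove ?_
    rintro ⟨b, hb⟩
    obtain ⟨p, hp, hp'⟩ := Nat.exists_infinite_primes (b + n + 2)
    have := hb (show p ∈ Set.ofPred fun p : ℕ => p.Prime ∧ n + 1 < p from ⟨hp', by omega⟩)
    omega
  exact (Nat.nth_mem_of_infinite hinf i).2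

lemma a_succ_pos {n j : ℕ} (i : ℕ) (hj : j ≤ n) : 0 < a n (i + 1) j := by
  have h := lt_q_succ n i
  have h' : (j : ℝ) < (q n (i + 1) : ℝ) := by exact_mod_cast (by omega : j < q n (i + 1))
  exact one_div_pos.2 (sub_pos.2 h')

lemma eval_fTilde_pos {n d : ℕ} (hd : Even d) (i : ℕ) (x : Fin n → ℝ) :
    0 < eval x (fTilde n d i) := by
  simp only [fTilde, map_add, map_sum, map_mul, eval_C, map_one]
  refine add_pos_of_pos_of_nonneg (a_succ_pos i n.zero_le) (Finset.sum_nonneg fun j _ => ?_)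
  refine mul_nonneg (a_succ_pos i j.2).le ?_
  linarith [neg_one_le_eval_chebyshev hd j x]

/-! ### Lagrange multipliers for polynomials -/

lemma hasStrictFDerivAt_eval {n : ℕ} (p : MvPolynomial (Fin n) ℝ) (x : Fin n → ℝ) :
    HasStrictFDerivAt (fun y => eval y p)
      (∑ j, eval x (pderiv j p) • ContinuousLinearMap.proj (R := ℝ) (φ := fun _ : Fin n => ℝ) j)
      x := by
  induction p using MvPolynomial.induction_on with
  | C c => simpa using hasStrictFDerivAt_const (𝕜 := ℝ) c x
  | add p r hp hr =>
    simp only [map_add, add_smul, Finset.sum_add_distrib]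
    exact hp.add hr
  | mul_X p i hp =>
    have hX : HasStrictFDerivAt (fun y : Fin n → ℝ => y i)
        (ContinuousLinearMap.proj (R := ℝ) (φ := fun _ : Fin n => ℝ) i) x :=
      (ContinuousLinearMap.proj (R := ℝ) (φ := fun _ : Fin n => ℝ) i).hasStrictFDerivAt
    simp only [map_mul, eval_X]
    refine (hp.mul hX).congr_fderiv ?_
    ext v
    simp [Derivation.leibniz, pderiv_X, Pi.single_apply, add_mul, Finset.sum_add_distrib,
      Finset.mul_sum, apply_ite (eval x), mul_assoc]

/-- Fritz John conditions with few constraints: if `p` has a local minimum at `z` on the zero set of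
the `h i`, `i ∈ S`, then `∇ p` and the `∇ (h i)` are linearly dependent at `z` for `i` in a
subset `S'` of at most `n` indices. When `S` itself is larger than that, any `n` of its elements
will do, since `n + 1` vectors of `ℝⁿ` are always dependent. -/
lemma exists_multipliers_of_isLocalMinOn {n : ℕ} {ι : Type} (S : Finset ι)
    (h : ι → MvPolynomial (Fin n) ℝ) (p : MvPolynomial (Fin n) ℝ) (z : Fin n → ℝ)
    (hz : ∀ i ∈ S, eval z (h i) = 0)
    (hmin : IsLocalMinOn (fun y => eval y p) {x | ∀ i ∈ S, eval x (h i) = 0} z) :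
    ∃ S' ⊆ S, S'.card ≤ n ∧ ∃ v : Option {i // i ∈ S'} → ℝ, v ≠ 0 ∧
      ∀ j, v none * eval z (pderiv j p) =
        ∑ i : {i // i ∈ S'}, v (some i) * eval z (pderiv j (h i)) := by
  rcases le_or_gt S.card n with hS | hS
  · refine ⟨S, subset_rfl, hS, ?_⟩
    have hset : {x | ∀ i ∈ S, eval x (h i) = 0} =
        {x | ∀ i : {i // i ∈ S}, eval x (h i) = eval z (h i)} := by
      ext x
      simp only [Set.mem_ofPred_eq, Subtype.forall]
      exact forall₂_congr fun i hi => by rw [hz i hi]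
    rw [hset] at hmin
    obtain ⟨Λ, Λ₀, hne, hsum⟩ := IsLocalExtrOn.exists_multipliers_of_hasStrictFDerivAt
      (Or.inl hmin) (fun i : {i // i ∈ S} => hasStrictFDerivAt_eval (h i) z)
      (hasStrictFDerivAt_eval p z)
    refine ⟨fun o => o.elim (-Λ₀) Λ, ?_, fun j => ?_⟩
    · contrapose! hne
      have h0 : -Λ₀ = 0 := congrFun hne none
      have h1 : Λ = 0 := funext fun i => congrFun hne (some i)
      simp [h1, neg_eq_zero.1 h0]
    · have := DFunLike.congr_fun hsum (Pi.single j 1)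
      simp [Pi.single_apply, -Finset.univ_eq_attach] at this
      simp only [Option.elim]
      linarith
  · obtain ⟨S', hS', hcard⟩ := Finset.exists_subset_card_eq hS.le
    refine ⟨S', hS', hcard.le, ?_⟩
    let w : Option {i // i ∈ S'} → Fin n → ℝ :=
      fun o => o.elim (fun j => -eval z (pderiv j p)) (fun i j => eval z (pderiv j (h i)))
    have hw : ¬ LinearIndependent ℝ w := fun hli => by
      have := hli.fintype_card_le_finrank
      simp [hcard] at this
    obtain ⟨v, hv, i, hi⟩ := Fintype.not_linearIndependent_iff.1 hw
    refine ⟨v, fun h0 => hi (congrFun h0 i), fun j => ?_⟩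
    have := congrFun hv j
    simp [Fintype.sum_option, w, -Finset.univ_eq_attach] at this
    linarith

/-! ### Minimizers of the deformed problem -/

/-- The real version of `G`. -/
def realG {n : ℕ} (d : ℕ) (g : MvPolynomial (Fin n) ℝ) (t : ℝ) : MvPolynomial (Fin n) ℝ :=
  C t * g + C (1 - t) * gTilde n d

/-- The real version of `F`. -/
def realF {n m : ℕ} (d : ℕ) (f : Fin m → MvPolynomial (Fin n) ℝ) (i : Fin m) (ε : ℤˣ) (t : ℝ) :
    MvPolynomial (Fin n) ℝ :=
  C t * f i + C (((ε : ℤ) : ℝ) * (1 - t)) * fTilde n d i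

lemma map_realG {n : ℕ} (d : ℕ) (g : MvPolynomial (Fin n) ℝ) (t : ℝ) :
    map Complex.ofRealHom (realG d g t) = G d g (t : ℂ) := by
  simp [realG, G]

lemma map_realF {n m : ℕ} (d : ℕ) (f : Fin m → MvPolynomial (Fin n) ℝ) (i : Fin m) (ε : ℤˣ)
    (t : ℝ) : map Complex.ofRealHom (realF d f i ε t) = F d f i ε (t : ℂ) := by
  simp [realF, F]

lemma eval_ofReal_map {n : ℕ} (p : MvPolynomial (Fin n) ℝ) (x : Fin n → ℝ) :
    eval (fun j => (x j : ℂ)) (map Complex.ofRealHom p) = (eval x p : ℂ) := by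
  rw [eval_map]
  exact eval₂_comp_left Complex.ofRealHom (RingHom.id ℝ) x p |>.symm

lemma eval_realF {n m : ℕ} (d : ℕ) (f : Fin m → MvPolynomial (Fin n) ℝ) (i : Fin m) (ε : ℤˣ)
    (t : ℝ) (x : Fin n → ℝ) :
    eval x (realF d f i ε t) =
      t * eval x (f i) + ((ε : ℤ) : ℝ) * (1 - t) * eval x (fTilde n d i) := by
  simp [realF]

lemma eval_realG {n : ℕ} (d : ℕ) (g : MvPolynomial (Fin n) ℝ) (t : ℝ) (x : Fin n → ℝ) :
    eval x (realG d g t) = t * eval x g + (1 - t) * eval x (gTilde n d) := by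
  simp [realG]

/-- The feasible set of the deformed problem: `F_i⁺ ≥ 0` for all `i`, and `F_i⁻ ≤ 0` for the
indices `i` of the equations. -/
def relaxedSet {n m : ℕ} (l d : ℕ) (f : Fin m → MvPolynomial (Fin n) ℝ) (t : ℝ) :
    Set (Fin n → ℝ) :=
  {x | ∀ i, 0 ≤ eval x (realF d f i 1 t) ∧ ((i : ℕ) < l → eval x (realF d f i (-1) t) ≤ 0)}

lemma realF_neg_one_lt {n m d : ℕ} (hd : Even d) (f : Fin m → MvPolynomial (Fin n) ℝ) (i : Fin m)
    {t : ℝ} (ht : t < 1) (x : Fin n → ℝ) :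
    eval x (realF d f i (-1) t) < eval x (realF d f i 1 t) := by
  have := mul_pos (sub_pos.2 ht) (eval_fTilde_pos hd (i : ℕ) x)
  simp only [eval_realF, Units.val_neg, Units.val_one, Int.cast_neg, Int.cast_one]
  linarith

lemma feasibleSet_subset_relaxedSet {n m l d : ℕ} (hd : Even d)
    (f : Fin m → MvPolynomial (Fin n) ℝ) {t : ℝ} (ht0 : 0 ≤ t) (ht : t ≤ 1) :
    feasibleSet l f ⊆ relaxedSet l d f t := by
  intro x hx i
  have h1 := mul_nonneg (sub_nonneg.2 ht) (eval_fTilde_pos hd (i : ℕ) x).le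
  simp only [eval_realF, Units.val_neg, Units.val_one, Int.cast_neg, Int.cast_one]
  refine ⟨?_, fun hi => ?_⟩
  · have h2 : 0 ≤ t * eval x (f i) := by
      rcases lt_or_ge (i : ℕ) l with hi | hi
      · simp [hx.1 i hi]
      · exact mul_nonneg ht0 (hx.2 i hi)
    linarith
  · rw [hx.1 i hi]
    linarith

lemma isClosed_relaxedSet {n m : ℕ} (l d : ℕ) (f : Fin m → MvPolynomial (Fin n) ℝ) (t : ℝ) :
    IsClosed (relaxedSet l d f t) := by
  simp only [relaxedSet, Set.ofPred_forall, Set.ofPred_and]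
  refine isClosed_iInter fun i => (isClosed_le continuous_const (continuous_eval _)).inter ?_
  exact isClosed_iInter fun _ => isClosed_le (continuous_eval _) continuous_const

/-- At a local minimizer of the deformed problem the active constraints can be singled out with
signs: near the point, the zero set of the active `F_i^{τ_i}` stays inside the deformed feasible set,
because `F_i⁻ < F_i⁺`. -/
lemma exists_fritzJohn_of_isLocalMinOn {n m l d : ℕ} (hd : Even d)
    (f : Fin m → MvPolynomial (Fin n) ℝ) (p : MvPolynomial (Fin n) ℝ) {t : ℝ} (ht : t < 1)
    {z : Fin n → ℝ} (hz : z ∈ relaxedSet l d f t)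
    (hmin : IsLocalMinOn (fun y => eval y p) (relaxedSet l d f t) z) :
    ∃ (S : Finset (Fin m)) (σ : {i // i ∈ S} → ℤˣ), S.card ≤ n ∧
      (∀ i : {i // i ∈ S}, l ≤ ((i : Fin m) : ℕ) → σ i = 1) ∧
      (∀ i : {i // i ∈ S}, eval z (realF d f i (σ i) t) = 0) ∧
      ∃ v : Option {i // i ∈ S} → ℝ, v ≠ 0 ∧ ∀ j, v none * eval z (pderiv j p) =
        ∑ i : {i // i ∈ S}, v (some i) * eval z (pderiv j (realF d f i (σ i) t)) := by
  classical
  let τ : Fin m → ℤˣ := fun i => if eval z (realF d f i 1 t) = 0 then 1 else -1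
  let A : Finset (Fin m) := {i | eval z (realF d f i 1 t) = 0 ∨
    ((i : ℕ) < l ∧ eval z (realF d f i (-1) t) = 0)}
  have hτ : ∀ i ∈ A, (τ i = 1 ∧ eval z (realF d f i 1 t) = 0) ∨
      (τ i = -1 ∧ (i : ℕ) < l ∧ eval z (realF d f i (-1) t) = 0) := by
    intro i hi
    simp only [A, Finset.mem_filter, Finset.mem_univ, true_and] at hi
    by_cases h : eval z (realF d f i 1 t) = 0
    · exact Or.inl ⟨if_pos h, h⟩
    · exact Or.inr ⟨if_neg h, hi.resolve_left h⟩
  have hA : ∀ i ∈ A, eval z (realF d f i (τ i) t) = 0 := by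
    intro i hi
    rcases hτ i hi with ⟨h, h'⟩ | ⟨h, -, h'⟩ <;> rw [h, h']
  have hinactive : ∀ i ∉ A, ∀ᶠ x in 𝓝 z, 0 ≤ eval x (realF d f i 1 t) ∧
      ((i : ℕ) < l → eval x (realF d f i (-1) t) ≤ 0) := by
    intro i hi
    simp only [A, Finset.mem_filter, Finset.mem_univ, true_and, not_or, not_and] at hi
    refine Filter.Eventually.and ?_ ?_
    · exact ((continuous_eval (realF d f i 1 t)).continuousAt.eventually
        (lt_mem_nhds ((hz i).1.lt_of_ne' hi.1))).mono fun x hx => hx.le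
    · refine eventually_imp_distrib_left.2 fun hil => ?_
      exact ((continuous_eval (realF d f i (-1) t)).continuousAt.eventually
        (gt_mem_nhds (((hz i).2 hil).lt_of_ne (hi.2 hil)))).mono fun x hx => hx.le
  have hnear : ∀ᶠ x in 𝓝 z, ∀ i, i ∉ A → 0 ≤ eval x (realF d f i 1 t) ∧
      ((i : ℕ) < l → eval x (realF d f i (-1) t) ≤ 0) :=
    eventually_all.2 fun i => eventually_imp_distrib_left.2 (hinactive i)
  have hmin' : IsLocalMinOn (fun y => eval y p)
      {x | ∀ i ∈ A, eval x (realF d f i (τ i) t) = 0} z := by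
    refine eventually_inf_principal.2 ?_
    filter_upwards [hnear, eventually_inf_principal.1 hmin] with x hx hxmin hxA
    refine hxmin fun i => ?_
    by_cases hi : i ∈ A
    · have hlt := realF_neg_one_lt hd f i ht x
      have h0 := hxA i hi
      rcases hτ i hi with ⟨h, -⟩ | ⟨h, -, -⟩ <;> rw [h] at h0
      · exact ⟨h0.ge, fun _ => by linarith⟩
      · exact ⟨by linarith, fun _ => h0.le⟩
    · exact hx i hi
  obtain ⟨S, hSA, hcard, v, hv, hgrad⟩ :=
    exists_multipliers_of_isLocalMinOn A (fun i => realF d f i (τ i) t) p z hA hmin'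
  refine ⟨S, fun i => τ i, hcard, fun i hi => ?_, fun i => hA i (hSA i.2), v, hv, hgrad⟩
  rcases hτ i (hSA i.2) with ⟨h, -⟩ | ⟨-, h, -⟩
  · exact h
  · exact absurd h hi.not_gt

/-! ### Isolating a compact connected component -/

/-- A compact connected component of a closed subset `A` of a proper space has arbitrarily small
bounded open neighbourhoods whose frontier misses `A`: in a compact Hausdorff space a component is
the intersection of the clopen sets that contain it. -/
lemma exists_isOpen_frontier_inter_eq_empty {X : Type*} [MetricSpace X] [ProperSpace X]
    {A : Set X} (hA : IsClosed A) {x : X} (hx : x ∈ A)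
    (hcompact : IsCompact (connectedComponentIn A x)) {U : Set X} (hU : IsOpen U)
    (hCU : connectedComponentIn A x ⊆ U) :
    ∃ W, IsOpen W ∧ IsCompact (closure W) ∧ x ∈ W ∧ W ⊆ U ∧ frontier W ∩ A = ∅ := by
  -- A compact neighbourhood of the component inside `U`; its trace on `A` is compact.
  obtain ⟨K, hK, hCK, hKU⟩ := exists_compact_between hcompact hU hCU
  set C := connectedComponentIn A x with hCdef
  have hxC : x ∈ C := mem_connectedComponentIn hx
  let Y : Set X := A ∩ K
  have hY : IsCompact Y := hK.inter_left hA
  have hCY : C ⊆ Y := fun y hy => ⟨connectedComponentIn_subset A x hy, interior_subset (hCK hy)⟩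
  have : CompactSpace Y := isCompact_iff_compactSpace.1 hY
  let x' : Y := ⟨x, hCY hxC⟩
  have hcomp : connectedComponent x' ⊆ Subtype.val ⁻¹' interior K := by
    intro y hy
    refine hCK ?_
    have hpre : IsPreconnected (Subtype.val '' connectedComponent x') :=
      isPreconnected_connectedComponent.image _ continuous_subtype_val.continuousOn
    refine hpre.subset_connectedComponentIn ⟨x', mem_connectedComponent, rfl⟩ ?_ ⟨y, hy, rfl⟩
    rintro _ ⟨y, -, rfl⟩
    exact y.2.1
  -- By compactness a single clopen set `Q` of `Y` separates `x` from the frontier of `K`.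
  obtain ⟨Q, hQ, hxQ, hQK⟩ : ∃ Q : Set Y, IsClopen Q ∧ x' ∈ Q ∧ Q ⊆ Subtype.val ⁻¹' interior K := by
    rw [connectedComponent_eq_iInter_isClopen] at hcomp
    have : Nonempty {s : Set Y // IsClopen s ∧ x' ∈ s} := ⟨⟨Set.univ, isClopen_univ, trivial⟩⟩
    obtain ⟨Q, hQ⟩ := exists_subset_nhds_of_isCompact
      (V := fun s : {s : Set Y // IsClopen s ∧ x' ∈ s} => (s : Set Y))
      (fun s t => ⟨⟨s.1 ∩ t.1, s.2.1.inter t.2.1, s.2.2, t.2.2⟩,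
        Set.inter_subset_left, Set.inter_subset_right⟩)
      (fun s => s.2.1.isClosed.isCompact)
      (fun y hy => (isOpen_interior.preimage continuous_subtype_val).mem_nhds (hcomp hy))
    exact ⟨Q, Q.2.1, Q.2.2, hQ⟩
  have hQ1 : IsCompact (Subtype.val '' Q) := hQ.isClosed.isCompact.image continuous_subtype_val
  have hQ2 : IsClosed (Subtype.val '' Qᶜ) :=
    (hQ.compl.isClosed.isCompact.image continuous_subtype_val).isClosed
  have hsub : Subtype.val '' Q ⊆ interior K ∩ (Subtype.val '' Qᶜ)ᶜ := by
    rintro _ ⟨y, hy, rfl⟩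
    refine ⟨hQK hy, ?_⟩
    rintro ⟨y', hy', h⟩
    exact hy' (Subtype.ext h ▸ hy)
  obtain ⟨L, hL, hQL, hLK⟩ :=
    exists_compact_between hQ1 (isOpen_interior.inter hQ2.isOpen_compl) hsub
  have hclos : closure (interior L) ⊆ L := closure_minimal interior_subset hL.isClosed
  refine ⟨interior L, isOpen_interior, hL.of_isClosed_subset isClosed_closure hclos,
    hQL ⟨x', hxQ, rfl⟩,
    fun y hy => hKU (interior_subset (hLK (interior_subset hy)).1), ?_⟩
  refine Set.eq_empty_of_forall_notMem fun y hy => ?_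
  have hyL := hLK (hclos hy.1.1)
  have hyY : y ∈ Y := ⟨hy.2, interior_subset hyL.1⟩
  by_cases hyQ : (⟨y, hyY⟩ : Y) ∈ Q
  · refine hy.1.2 ?_
    rw [interior_interior]
    exact hQL ⟨_, hyQ, rfl⟩
  · exact hyL.2 ⟨_, hyQ, rfl⟩

lemma isClosed_feasibleSet {n m : ℕ} (l : ℕ) (f : Fin m → MvPolynomial (Fin n) ℝ) :
    IsClosed (feasibleSet l f) := by
  simp only [feasibleSet, Set.ofPred_forall, Set.ofPred_and]
  refine IsClosed.inter ?_ ?_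
  · exact isClosed_iInter fun i => isClosed_iInter fun _ =>
      isClosed_eq (continuous_eval _) continuous_const
  · exact isClosed_iInter fun i => isClosed_iInter fun _ =>
      isClosed_le continuous_const (continuous_eval _)

lemma isClosed_minimizers {n m : ℕ} (l : ℕ) (f : Fin m → MvPolynomial (Fin n) ℝ)
    (g : MvPolynomial (Fin n) ℝ) : IsClosed (minimizers l f g) := by
  have : minimizers l f g =
      feasibleSet l f ∩ ⋂ y ∈ feasibleSet l f, {x | eval x g ≤ eval y g} := by
    ext x
    simp [minimizers, isMinOn_iff]
  rw [this]
  exact (isClosed_feasibleSet l f).inter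
    (isClosed_biInter fun y _ => isClosed_le (continuous_eval _) continuous_const)

/-! ### Fritz John points of the deformed problem near the component -/

/-- A limit, for `t → 1`, of feasible points of the deformed problems whose values do not exceed the
one at a minimizer `x₀` of the original problem is itself a minimizer of the original problem. -/
lemma mem_minimizers_of_tendsto {n m l d : ℕ} {f : Fin m → MvPolynomial (Fin n) ℝ}
    {g : MvPolynomial (Fin n) ℝ} {x₀ : Fin n → ℝ} (hx₀ : x₀ ∈ minimizers l f g)
    {t : ℕ → ℝ} (ht : Tendsto t atTop (𝓝 1)) {z : ℕ → Fin n → ℝ} {y : Fin n → ℝ}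
    (hz : Tendsto z atTop (𝓝 y)) (hmem : ∀ k, z k ∈ relaxedSet l d f (t k))
    (hle : ∀ k, eval (z k) (realG d g (t k)) ≤ eval x₀ (realG d g (t k))) :
    y ∈ minimizers l f g := by
  have hev : ∀ p : MvPolynomial (Fin n) ℝ, Tendsto (fun k => eval (z k) p) atTop (𝓝 (eval y p)) :=
    fun p => ((continuous_eval p).tendsto y).comp hz
  have ht' : Tendsto (fun k => 1 - t k) atTop (𝓝 0) := by
    simpa using tendsto_const_nhds (x := (1 : ℝ)).sub ht
  have hF : ∀ i ε, Tendsto (fun k => eval (z k) (realF d f i ε (t k))) atTop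
      (𝓝 (eval y (f i))) := by
    intro i ε
    simp only [eval_realF]
    simpa using (ht.mul (hev (f i))).add
      ((ht'.const_mul ((ε : ℤ) : ℝ)).mul (hev (fTilde n d i)))
  have hpos : ∀ i, 0 ≤ eval y (f i) := fun i =>
    ge_of_tendsto' (hF i 1) fun k => (hmem k i).1
  have hfeas : y ∈ feasibleSet l f := by
    refine ⟨fun i hi => le_antisymm ?_ (hpos i), fun i _ => hpos i⟩
    exact le_of_tendsto' (hF i (-1)) fun k => (hmem k i).2 hi
  have hg : eval y g ≤ eval x₀ g := by
    have h1 : Tendsto (fun k => eval (z k) (realG d g (t k))) atTop (𝓝 (eval y g)) := by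
      simp only [eval_realG]
      simpa using (ht.mul (hev g)).add (ht'.mul (hev (gTilde n d)))
    have h2 : Tendsto (fun k => eval x₀ (realG d g (t k))) atTop (𝓝 (eval x₀ g)) := by
      simp only [eval_realG]
      simpa using (ht.mul_const (eval x₀ g)).add (ht'.mul_const (eval x₀ (gTilde n d)))
    exact le_of_tendsto_of_tendsto' h1 h2 hle
  exact ⟨hfeas, fun w hw => hg.trans (hx₀.2 hw)⟩

/-- Near a compact connected component of the set of minimizers, the deformed problems with `t < 1`
close to `1` have local minimizers. -/
lemma exists_isLocalMinOn_relaxedSet {n m l d : ℕ} (hd : Even d)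
    (f : Fin m → MvPolynomial (Fin n) ℝ) (g : MvPolynomial (Fin n) ℝ) {x₀ : Fin n → ℝ}
    (hx₀ : x₀ ∈ minimizers l f g)
    (hcompact : IsCompact (connectedComponentIn (minimizers l f g) x₀))
    {U : Set (Fin n → ℝ)} (hU : IsOpen U) (hCU : connectedComponentIn (minimizers l f g) x₀ ⊆ U)
    {δ : ℝ} (hδ : 0 < δ) :
    ∃ t : ℝ, 1 - δ < t ∧ t < 1 ∧ ∃ z ∈ U, z ∈ relaxedSet l d f t ∧
      IsLocalMinOn (fun y => eval y (realG d g t)) (relaxedSet l d f t) z := by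
  obtain ⟨W, hWo, hWc, hxW, hWU, hfr⟩ :=
    exists_isOpen_frontier_inter_eq_empty (isClosed_minimizers l f g) hx₀ hcompact hU hCU
  obtain ⟨t, -, htlt, ht⟩ := exists_seq_strictMono_tendsto' (zero_lt_one (α := ℝ))
  have hx₀mem : ∀ k, x₀ ∈ relaxedSet l d f (t k) := fun k =>
    feasibleSet_subset_relaxedSet hd f (htlt k).1.le (htlt k).2.le hx₀.1
  have hex : ∀ k, ∃ z ∈ closure W ∩ relaxedSet l d f (t k),
      IsMinOn (fun y => eval y (realG d g (t k))) (closure W ∩ relaxedSet l d f (t k)) z := fun k =>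
    (hWc.inter_right (isClosed_relaxedSet l d f (t k))).exists_isMinOn
      ⟨x₀, subset_closure hxW, hx₀mem k⟩ (continuous_eval _).continuousOn
  choose z hz hzmin using hex
  -- Otherwise infinitely many minimizers lie on the frontier of `W`, and so does a limit of them.
  have hev : ∀ᶠ k in atTop, z k ∈ W := by
    by_contra hnot
    obtain ⟨φ, hφ, hφW⟩ := extraction_of_frequently_atTop (not_eventually.1 hnot)
    have hfrc : IsCompact (frontier W) := hWc.of_isClosed_subset isClosed_frontier
      frontier_subset_closure
    obtain ⟨y, hy, ψ, hψ, hlim⟩ := hfrc.tendsto_subseq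
      (x := fun k => z (φ k)) fun k => ⟨(hz _).1, by rw [hWo.interior_eq]; exact hφW k⟩
    have hymin : y ∈ minimizers l f g :=
      mem_minimizers_of_tendsto hx₀
        (ht.comp (hφ.tendsto_atTop.comp hψ.tendsto_atTop)) hlim (fun k => (hz _).2)
        (fun k => hzmin _ ⟨subset_closure hxW, hx₀mem _⟩)
    exact (hfr ▸ (⟨hy, hymin⟩ : y ∈ frontier W ∩ minimizers l f g) : y ∈ (∅ : Set _))
  obtain ⟨k, hkW, hkt⟩ := (hev.and (ht.eventually (lt_mem_nhds (sub_lt_self 1 hδ)))).exists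
  refine ⟨t k, hkt, (htlt k).2, z k, hWU hkW, (hz k).2, ?_⟩
  refine eventually_inf_principal.2 ?_
  filter_upwards [hWo.mem_nhds hkW] with y hyW hy
  exact hzmin k ⟨subset_closure hyW, hy⟩

/-! ### Comparison of the Zariski topology with the Euclidean one -/

/-- Triples `(t, x, v)` with `v ≠ 0`: the affine cone over `Space`. -/
abbrev Cone (n : ℕ) (ι : Type) : Type :=
  ℂ × (Fin n → ℂ) × {v : Option ι → ℂ // v ≠ 0}

/-- The projection of the affine cone to `Space`, with `[v]` as third component. -/
def Cone.toSpace {n : ℕ} {ι : Type} (P : Cone n ι) : Space n ι :=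
  ⟨P.1, P.2.1, Projectivization.mk ℂ P.2.2.1 P.2.2.2⟩

/-- The coordinates of a point of the affine cone. -/
def Cone.coords {n : ℕ} {ι : Type} (P : Cone n ι) : Option (Fin n) ⊕ Option ι → ℂ :=
  Sum.elim (fun o => o.elim P.1 P.2.1) P.2.2.1

/-- For a polynomial homogeneous in `λ`, vanishing does not depend on the representative. -/
lemma Cone.toSpace_mem_lamZeroLocus {n : ℕ} {ι : Type}
    {p : MvPolynomial (Option (Fin n) ⊕ Option ι) ℂ} {k : ℕ}
    (hp : IsWeightedHomogeneous (lamWeight n ι) p k) (P : Cone n ι) :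
    P.toSpace ∈ lamZeroLocus p ↔ eval P.coords p = 0 := by
  refine ⟨fun h => h P.2.2.1 P.2.2.2 rfl, fun h v hv hvP => ?_⟩
  obtain ⟨c, hc⟩ := (Projectivization.mk_eq_mk_iff' ℂ _ _ hv P.2.2.2).1 hvP
  have hcoords : (Sum.elim (fun o => o.elim P.1 P.2.1) v : Option (Fin n) ⊕ Option ι → ℂ) =
      fun i => c ^ lamWeight n ι i * P.coords i := by
    funext i
    rcases i with i | i
    · simp [lamWeight, Cone.coords]
    · simp [lamWeight, Cone.coords, ← hc]
  have hhom : eval (fun i => c ^ lamWeight n ι i * P.coords i) p = c ^ k * eval P.coords p := by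
    rw [eval_eq, eval_eq, Finset.mul_sum]
    refine Finset.sum_congr rfl fun e he => ?_
    have hdeg : ∑ i ∈ e.support, lamWeight n ι i * e i = k := by
      have := hp (mem_support_iff.1 he)
      simpa [Finsupp.weight_apply, Finsupp.sum, mul_comm] using this
    simp only [mul_pow, Finset.prod_mul_distrib, ← pow_mul, Finset.prod_pow_eq_pow_sum, hdeg]
    ring
  change eval (Sum.elim (fun o => o.elim P.1 P.2.1) v) p = 0
  rw [hcoords, hhom, h, mul_zero]

/-- Zariski closed sets are closed in the Euclidean topology. -/
lemma Cone.continuous_toSpace {n : ℕ} {ι : Type} :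
    Continuous (Cone.toSpace : Cone n ι → Space n ι) := by
  refine continuous_generateFrom_iff.2 ?_
  rintro _ ⟨p, k, hp, rfl⟩
  have hpre : (Cone.toSpace ⁻¹' (lamZeroLocus p)ᶜ : Set (Cone n ι)) =
      (fun P : Cone n ι => eval P.coords p) ⁻¹' {0}ᶜ := by
    ext P
    simp [Cone.toSpace_mem_lamZeroLocus hp]
  rw [hpre]
  refine isOpen_compl_singleton.preimage ((continuous_eval p).comp (continuous_pi fun i => ?_))
  rcases i with (_ | i) | i <;> simp only [Cone.coords, Sum.elim_inl, Sum.elim_inr, Option.elim]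
  · fun_prop
  · fun_prop
  · exact (continuous_apply i).comp (continuous_subtype_val.comp continuous_snd.snd)

lemma Cone.toSpace_surjective {n : ℕ} {ι : Type} :
    Function.Surjective (Cone.toSpace : Cone n ι → Space n ι) := by
  rintro ⟨t, x, w⟩
  induction w using Projectivization.ind with
  | h v hv => exact ⟨(t, x, ⟨v, hv⟩), rfl⟩

/-- By Hilbert's basis theorem: `Space` is the image of the affine cone, which with its Zariski
topology is a subspace of the spectrum of a polynomial ring. -/
instance noetherianSpace_space (n : ℕ) (ι : Type) [Finite ι] :
    TopologicalSpace.NoetherianSpace (Space n ι) := by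
  let e : Cone n ι → PrimeSpectrum (MvPolynomial (Option (Fin n) ⊕ Option ι) ℂ) :=
    fun P => pointToPoint P.coords
  let _ : TopologicalSpace (Cone n ι) := TopologicalSpace.induced e inferInstance
  have he : Topology.IsInducing e := ⟨rfl⟩
  have : TopologicalSpace.NoetherianSpace (Cone n ι) := he.noetherianSpace
  refine TopologicalSpace.noetherianSpace_of_surjective Cone.toSpace ?_ Cone.toSpace_surjective
  refine continuous_generateFrom_iff.2 ?_
  rintro _ ⟨p, k, hp, rfl⟩
  refine isOpen_induced_iff.2 ⟨PrimeSpectrum.basicOpen p, (PrimeSpectrum.basicOpen p).isOpen, ?_⟩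
  ext P
  have : p ∈ (e P).asIdeal ↔ eval P.coords p = 0 := by
    simp [e, pointToPoint, aeval_eq_eval]
  simp [Cone.toSpace_mem_lamZeroLocus hp, this]

/-- The gradient condition in `V̂_{S,σ}` may be tested on one representative of `λ`. -/
lemma Cone.toSpace_mem_Vhat {n m : ℕ} {d : ℕ} {f : Fin m → MvPolynomial (Fin n) ℝ}
    {g : MvPolynomial (Fin n) ℝ} {S : Finset (Fin m)} {σ : {i // i ∈ S} → ℤˣ}
    (P : Cone n {i // i ∈ S}) :
    P.toSpace ∈ Vhat d f g S σ ↔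
      (∀ i : {i // i ∈ S}, eval P.2.1 (F d f i (σ i) P.1) = 0) ∧
      ∀ j : Fin n, P.2.2.1 none * eval P.2.1 (pderiv j (G d g P.1)) =
        ∑ i : {i // i ∈ S}, P.2.2.1 (some i) * eval P.2.1 (pderiv j (F d f i (σ i) P.1)) := by
  refine ⟨fun h => ⟨h.1, h.2 P.2.2.1 P.2.2.2 rfl⟩, fun h => ⟨h.1, fun v hv hvP j => ?_⟩⟩
  obtain ⟨c, rfl⟩ := (Projectivization.mk_eq_mk_iff' ℂ _ _ hv P.2.2.2).1 hvP
  simp only [Pi.smul_apply, smul_eq_mul, mul_assoc, ← Finset.mul_sum]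
  exact congrArg (c * ·) (h.2 j)

/-- `V̂_{S,σ}` is closed in the Euclidean topology of the affine cone. -/
lemma isClosed_preimage_Vhat {n m : ℕ} (d : ℕ) (f : Fin m → MvPolynomial (Fin n) ℝ)
    (g : MvPolynomial (Fin n) ℝ) (S : Finset (Fin m)) (σ : {i // i ∈ S} → ℤˣ) :
    IsClosed (Cone.toSpace ⁻¹' Vhat d f g S σ) := by
  have hev : ∀ p : MvPolynomial (Fin n) ℂ,
      Continuous fun P : Cone n {i // i ∈ S} => eval P.2.1 p :=
    fun p => (continuous_eval p).comp continuous_snd.fst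
  have hv : ∀ o : Option {i // i ∈ S},
      Continuous fun P : Cone n {i // i ∈ S} => P.2.2.1 o :=
    fun o => (continuous_apply o).comp (continuous_subtype_val.comp continuous_snd.snd)
  simp only [Set.preimage, Cone.toSpace_mem_Vhat, Set.ofPred_and, Set.ofPred_forall]
  refine IsClosed.inter (isClosed_iInter fun i => isClosed_eq ?_ continuous_const)
    (isClosed_iInter fun j => isClosed_eq ((hv none).mul ?_)
      (continuous_finsetSum _ fun i _ => (hv (some i)).mul ?_))
  · simp only [F, map_add, map_mul, eval_C]
    have h1 := hev (map Complex.ofRealHom (f i))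
    have h2 := hev (map Complex.ofRealHom (fTilde n d i))
    fun_prop
  · simp only [G, map_add, map_mul, eval_C, Derivation.leibniz, smul_eq_mul, pderiv_C, mul_zero,
      add_zero]
    have h1 := hev (pderiv j (map Complex.ofRealHom g))
    have h2 := hev (pderiv j (map Complex.ofRealHom (gTilde n d)))
    fun_prop
  · simp only [F, map_add, map_mul, eval_C, Derivation.leibniz, smul_eq_mul, pderiv_C, mul_zero,
      add_zero]
    have h1 := hev (pderiv j (map Complex.ofRealHom (f i)))
    have h2 := hev (pderiv j (map Complex.ofRealHom (fTilde n d i)))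
    fun_prop

/-! ### Passing to the limit -/

/-- Fritz John points of the deformed problem arbitrarily near the component and with `t < 1`
arbitrarily close to `1`, as points of `V̂_{S,σ}` with normalized multipliers. -/
lemma exists_mem_Vhat_near {n m l d : ℕ} (hd : Even d)
    (f : Fin m → MvPolynomial (Fin n) ℝ) (g : MvPolynomial (Fin n) ℝ) {x₀ : Fin n → ℝ}
    (hx₀ : x₀ ∈ minimizers l f g)
    (hcompact : IsCompact (connectedComponentIn (minimizers l f g) x₀)) {δ : ℝ} (hδ : 0 < δ) :
    ∃ (S : Finset (Fin m)) (σ : {i // i ∈ S} → ℤˣ), S.card ≤ n ∧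
      (∀ i : {i // i ∈ S}, l ≤ ((i : Fin m) : ℕ) → σ i = 1) ∧
      ∃ (t : ℝ) (c z : Fin n → ℝ) (v : {v : Option {i // i ∈ S} → ℂ // v ≠ 0}),
        1 - δ < t ∧ t < 1 ∧ c ∈ connectedComponentIn (minimizers l f g) x₀ ∧ dist c z < δ ∧
        ‖v.1‖ = 1 ∧ Cone.toSpace ((t : ℂ), (fun j => (z j : ℂ)), v) ∈ Vhat d f g S σ := by
  obtain ⟨t, ht, ht1, z, hzU, hz, hmin⟩ :=
    exists_isLocalMinOn_relaxedSet hd f g hx₀ hcompact Metric.isOpen_thickening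
      (Metric.self_subset_thickening hδ _) hδ
  obtain ⟨c, hc, hcz⟩ := Metric.mem_thickening_iff.1 hzU
  obtain ⟨S, σ, hcard, hσ, hF, v, hv, hgrad⟩ :=
    exists_fritzJohn_of_isLocalMinOn hd f (realG d g t) ht1 hz hmin
  have hnorm : ‖v‖ ≠ 0 := norm_ne_zero_iff.2 hv
  have hunit : ‖(fun o => ((‖v‖⁻¹ * v o : ℝ) : ℂ))‖ = 1 := by
    have h1 : ‖(fun o => ((‖v‖⁻¹ * v o : ℝ) : ℂ))‖ = ‖‖v‖⁻¹ • v‖ := by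
      simp only [Pi.norm_def]
      congr 2
      ext o
      simp
    rw [h1, norm_smul, norm_inv, norm_norm, inv_mul_cancel₀ hnorm]
  refine ⟨S, σ, hcard, hσ, t, c, z, ⟨fun o => ((‖v‖⁻¹ * v o : ℝ) : ℂ), fun h0 => ?_⟩, ht, ht1, hc,
    by rwa [dist_comm], hunit, (Cone.toSpace_mem_Vhat _).2 ⟨fun i => ?_, fun j => ?_⟩⟩
  · rw [h0, norm_zero] at hunit
    exact zero_ne_one hunit
  · change eval (fun j => (z j : ℂ)) (F d f i (σ i) (t : ℂ)) = 0
    rw [← map_realF, eval_ofReal_map, hF i, Complex.ofReal_zero]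
  · change ((‖v‖⁻¹ * v none : ℝ) : ℂ) * eval (fun j => (z j : ℂ)) (pderiv j (G d g (t : ℂ))) =
      ∑ i : {i // i ∈ S}, ((‖v‖⁻¹ * v (some i) : ℝ) : ℂ) *
        eval (fun j => (z j : ℂ)) (pderiv j (F d f i (σ i) (t : ℂ)))
    simp only [← map_realF, ← map_realG, pderiv_map, eval_ofReal_map]
    rw [← Complex.ofReal_mul, mul_assoc, hgrad j, Finset.mul_sum, Complex.ofReal_sum]
    simp only [Complex.ofReal_mul, mul_assoc]

lemma exists_forall_of_antitone {ι : Type*} [Finite ι] {Q : ι → ℕ → Prop}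
    (hanti : ∀ i k k', k ≤ k' → Q i k' → Q i k) (hex : ∀ k, ∃ i, Q i k) : ∃ i, ∀ k, Q i k := by
  by_contra! hno
  choose N hN using hno
  obtain ⟨b, hb⟩ := (Set.finite_range N).bddAbove
  obtain ⟨i, hi⟩ := hex b
  exact hN i (hanti i _ _ (hb ⟨i, rfl⟩) hi)

end Deformation

end

theorem mainTheorem2 (n m l d : ℕ) (hn : 2 ≤ n) (hl : l ≤ m) (hd : Even d)
    (f : Fin m → MvPolynomial (Fin n) ℝ) (g : MvPolynomial (Fin n) ℝ)
    (hf : ∀ i, (f i).totalDegree ≤ d) (hg : g.totalDegree ≤ d)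
    (C : Set (Fin n → ℝ))
    (hC : ∃ x ∈ Deformation.minimizers l f g,
      C = connectedComponentIn (Deformation.minimizers l f g) x)
    (hcompact : IsCompact C) :
    ∃ z ∈ C, ∃ (S : Finset (Fin m)) (σ : {i // i ∈ S} → ℤˣ),
      S.card ≤ n ∧ (∀ i : {i // i ∈ S}, l ≤ ((i : Fin m) : ℕ) → σ i = 1) ∧
      (fun j => (z j : ℂ)) ∈
        (fun P : Deformation.Space n {i // i ∈ S} => P.x) ''
          (Deformation.V d f g S σ ∩ {P | P.t = 1}) := by
  open Deformation Filter Topology in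
  obtain ⟨x₀, hx₀, rfl⟩ := hC
  set C := connectedComponentIn (minimizers l f g) x₀
  -- One triple `(S, σ, Z)`, with `Z` a component of `V̂_{S,σ}`, serves all precisions `1 / (k + 1)`.
  have hfin : ∀ s : (S : Finset (Fin m)) × ({i // i ∈ S} → ℤˣ),
      Finite (irreducibleComponents (Vhat d f g s.1 s.2)) := fun s =>
    (TopologicalSpace.NoetherianSpace.finite_irreducibleComponents
      (α := Vhat d f g s.1 s.2)).to_subtype
  obtain ⟨⟨⟨S, σ⟩, Z, hZ⟩, hQ⟩ := exists_forall_of_antitone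
    (ι := (s : (S : Finset (Fin m)) × ({i // i ∈ S} → ℤˣ)) ×
      irreducibleComponents (Vhat d f g s.1 s.2))
    (Q := fun s k => s.1.1.card ≤ n ∧
      (∀ i : {i // i ∈ s.1.1}, l ≤ ((i : Fin m) : ℕ) → s.1.2 i = 1) ∧
      ∃ (t : ℝ) (c z : Fin n → ℝ) (v : {v : Option {i // i ∈ s.1.1} → ℂ // v ≠ 0}),
        1 - 1 / ((k : ℝ) + 1) < t ∧ t < 1 ∧ c ∈ C ∧ dist c z < 1 / ((k : ℝ) + 1) ∧ ‖v.1‖ = 1 ∧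
        Cone.toSpace ((t : ℂ), (fun j => (z j : ℂ)), v) ∈ Subtype.val '' s.2.1)
    (by
      rintro s k k' hk ⟨h1, h2, t, c, z, v, h3, h4, h5, h6, h7⟩
      have := Nat.one_div_le_one_div (α := ℝ) hk
      exact ⟨h1, h2, t, c, z, v, by linarith, h4, h5, by linarith, h7⟩)
    (fun k => by
      obtain ⟨S, σ, h1, h2, t, c, z, v, h3, h4, h5, h6, h7, h8⟩ :=
        exists_mem_Vhat_near hd f g hx₀ hcompact (Nat.one_div_pos_of_nat (α := ℝ) (n := k))
      exact ⟨⟨⟨S, σ⟩, irreducibleComponent ⟨_, h8⟩, irreducibleComponent_mem_irreducibleComponents _⟩,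
        h1, h2, t, c, z, v, h3, h4, h5, h6, h7, _, mem_irreducibleComponent, rfl⟩)
  dsimp only at Z hZ hQ
  choose hcard hσ t c z v htl ht1 hc hcz hv hmem using hQ
  -- A subsequence of the centres `c k` and of the multipliers `v k` converges.
  have hsphere : IsCompact (Metric.sphere (0 : Option {i // i ∈ S} → ℂ) 1) := isCompact_sphere _ _
  obtain ⟨⟨y, w⟩, ⟨hyC, hw⟩, φ, hφ, hlim⟩ := (hcompact.prod hsphere).tendsto_subseq
    (x := fun k => (c k, (v k).1)) fun k => ⟨hc k, by simpa using hv k⟩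
  have hw0 : w ≠ 0 := by
    rintro rfl
    simp at hw
  have hk : Tendsto (fun k : ℕ => 1 / ((k : ℝ) + 1)) atTop (𝓝 0) :=
    tendsto_one_div_add_atTop_nhds_zero_nat
  have htlim : Tendsto (fun k => t (φ k)) atTop (𝓝 1) := by
    refine Tendsto.comp (tendsto_of_tendsto_of_tendsto_of_le_of_le ?_ tendsto_const_nhds
      (fun k => (htl k).le) (fun k => (ht1 k).le)) hφ.tendsto_atTop
    simpa using tendsto_const_nhds (x := (1 : ℝ)).sub hk
  have hzlim : Tendsto (fun k => z (φ k)) atTop (𝓝 y) := by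
    refine tendsto_of_tendsto_of_dist ((continuous_fst.tendsto _).comp hlim) ?_
    exact squeeze_zero (fun _ => dist_nonneg) (fun k => (hcz (φ k)).le) (hk.comp hφ.tendsto_atTop)
  let P : ℕ → Cone n {i // i ∈ S} := fun k => ((t k : ℂ), (fun j => (z k j : ℂ)), v k)
  let P' : Cone n {i // i ∈ S} := ((1 : ℂ), (fun j => (y j : ℂ)), ⟨w, hw0⟩)
  have hPlim : Tendsto (fun k => P (φ k)) atTop (𝓝 P') := by
    refine Tendsto.prodMk_nhds ?_ (Tendsto.prodMk_nhds ?_ ?_)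
    · exact_mod_cast (Complex.continuous_ofReal.tendsto 1).comp htlim
    · exact tendsto_pi_nhds.2 fun j => (Complex.continuous_ofReal.tendsto _).comp
        (tendsto_pi_nhds.1 hzlim j)
    · exact tendsto_subtype_rng.2 ((continuous_snd.tendsto _).comp hlim)
  -- The limit stays in `Z`, which is the trace on `V̂_{S,σ}` of a Zariski closed set `T`.
  obtain ⟨T, hT, rfl⟩ := isClosed_induced_iff.1 (isClosed_of_mem_irreducibleComponents Z hZ)
  have hP : ∀ k, (P k).toSpace ∈ Vhat d f g S σ ∧ (P k).toSpace ∈ T := by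
    intro k
    obtain ⟨p, hp, hpk⟩ := hmem k
    have hpk' : p.1 = (P k).toSpace := hpk
    exact hpk' ▸ ⟨p.2, hp⟩
  have hP'V : P'.toSpace ∈ Vhat d f g S σ :=
    (isClosed_preimage_Vhat d f g S σ).mem_of_tendsto hPlim (Eventually.of_forall fun k => (hP _).1)
  have hP'T : P'.toSpace ∈ T :=
    (hT.preimage Cone.continuous_toSpace).mem_of_tendsto hPlim
      (Eventually.of_forall fun k => (hP _).2)
  refine ⟨y, hyC, S, σ, hcard 0, hσ 0, P'.toSpace, ⟨?_, rfl⟩, rfl⟩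
  refine Set.mem_biUnion ⟨hZ, ?_⟩ ⟨⟨_, hP'V⟩, hP'T, rfl⟩
  -- `Z` contains the limit, over `t = 1`, and the point `P 0`, over `t 0 < 1`.
  rintro ⟨t₀, ht₀⟩
  have h0 : (t 0 : ℂ) = t₀ := ht₀ ⟨_, (hP 0).1⟩ (hP 0).2
  have h1 : (1 : ℂ) = t₀ := ht₀ ⟨_, hP'V⟩ hP'T
  exact (ht1 0).ne (by exact_mod_cast h0.trans h1.symm)
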